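/- Let $G$ be a finite connected graph embedded on the sphere, and let $s\neq t$ be vertices of $G$. Each edge of $G$ consists of two oppositely directed darts, and paths are sequences of darts. Let $\phi$ be the minimum number of faces that a curve from $s$ to $t$ meeting $G$ only in vertices must pass through. Let $\Pi$ be a simple curve from $s$ to $t$ attaining this minimum, drawn as a path of $\phi$ artificial edges, one in each face it passes through. Choose distinct faces $f_s$ and $f_t$ of $G\cup\Pi$, incident to $s$ and $t$ respectively, and a corner of $f_s$ at $s$ and of $f_t$ at $t$. Removing the interiors of $f_s$ and $f_t$ from the sphere gives a cylinder with $s$ and $t$ on its two ends. Let $\mathcal G$ be the covering graph of $G$ obtained by lifting $G$ to the universal cover of this cylinder. The lifts of $\Pi$ (running from one end of the strip to the other, the chosen corners being the places where $\Pi$ meets the ends of the cylinder) cut the universal cover into consecutive pieces; the darts of $\mathcal G$ in one piece form a \emph{copy of $G$} in $\mathcal G$. Let $P$ be a simple path in $G$ (no vertex is repeated), and let $\bar P$ be an isomorphic copy of $P$ in $\mathcal G$, that is, a path of $\mathcal G$ that projects dart by dart to $P$. Then $\bar P$ contains darts of at most $\phi+2$ copies of $G$ in $\mathcal G$. If moreover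 neither $s$ nor $t$ is an inner vertex of $P$, then $\bar P$ contains darts of at most $\phi$ copies of $G$ in $\mathcal G$. -/

import Mathlib

/-- A connected plane graph (drawn on the sphere) in combinatorial form. Each edge consists of two
oppositely directed darts `d` and `rev d`; `nxt d` is the dart that follows `d` in the clockwise
order of the darts leaving the vertex `tail d`. Loops and parallel edges are allowed. -/
structure PlaneGraph (V D : Type*) [Fintype V] [Fintype D] where
  tail : D → V
  rev : Equiv.Perm D
  rev_rev : ∀ d, rev (rev d) = d
  rev_ne : ∀ d, rev d ≠ d
  nxt : Equiv.Perm D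
  /-- The darts leaving one vertex form exactly one cycle of the rotation. -/
  sameCycle_nxt : ∀ d e, nxt.SameCycle d e ↔ tail d = tail e
  /-- The graph is connected. -/
  connected : ∀ u v,
    Relation.ReflTransGen (fun x y => ∃ d, tail d = x ∧ tail (rev d) = y) u v
  /-- Euler's formula `|V| + |F| = |E| + 2`: the surface is a sphere. The faces are the cycles of
  `d ↦ nxt (rev d)`, which goes round the face on the left of `d`. -/
  euler : Nat.card V + Nat.card (Quotient (Equiv.Perm.SameCycle.setoid (nxt * rev))) =
    Nat.card D / 2 + 2

namespace PlaneGraph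

variable {V D : Type*} [Fintype V] [Fintype D] (G : PlaneGraph V D)

def head (d : D) : V := G.tail (G.rev d)

/-- The permutation that takes a dart to the next dart on the boundary of the face on its left. -/
def faceNext : Equiv.Perm D := G.nxt * G.rev

def Face : Type _ := Quotient (Equiv.Perm.SameCycle.setoid G.faceNext)

/-- The face on the left of a dart. -/
def leftFace (d : D) : G.Face := Quotient.mk (Equiv.Perm.SameCycle.setoid G.faceNext) d

/-- The closed walk round the face on the left of `d`, starting with `d`. -/
noncomputable def faceWalk (d : D) : List D :=
  List.iterate G.faceNext d (Function.minimalPeriod G.faceNext d)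

/-- The vertex `x` lies on the boundary of the face `f`. -/
def Incident (x : V) (f : G.Face) : Prop := ∃ d, G.tail d = x ∧ G.leftFace d = f

/-- The minimum number of faces that a curve from `s` to `t` passes through: the least `k` with
a sequence `s = x 0, f 0, x 1, f 1, …, f (k - 1), x k = t` of vertices and faces in which each face
is incident to the vertex before it and to the vertex after it. -/
noncomputable def phi (s t : V) : ℕ :=
  sInf {k : ℕ | ∃ (x : Fin (k + 1) → V) (f : Fin k → G.Face),
    x 0 = s ∧ x (Fin.last k) = t ∧
      ∀ i, G.Incident (x i.castSucc) (f i) ∧ G.Incident (x i.succ) (f i)}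

/-- The sequence of vertices of a path (empty for the path without darts). -/
def support : List D → List V
  | [] => []
  | d :: p => G.tail d :: (d :: p).map G.head

/-- `p` is a simple path: consecutive darts fit together and no vertex is repeated.
The empty list stands for every trivial (one-vertex) path. -/
def IsSimplePath (p : List D) : Prop :=
  p.IsChain (fun d e => G.head d = G.tail e) ∧ (G.support p).Nodup

/-- `w` is a walk from `u` to `v`. -/
def IsWalk : V → List D → V → Prop
  | u, [], v => u = v
  | u, d :: w, v => G.tail d = u ∧ IsWalk (G.head d) w v

end PlaneGraph

/-- A plane graph on a cylinder with `s` and `t` on its two ends: the cylinder is the sphere without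
the interiors of a face at `s` and another face at `t`. Besides the face, a corner of it at `s`
(at `t`) is chosen: the corner immediately to the left of the dart `cs` (of `ct`), that is, between
the dart before `cs` in the clockwise order and `cs`. It is the place where the end of the
cylinder touches `s`. -/
structure CylinderGraph (V D : Type*) [Fintype V] [Fintype D] (s t : V) extends
    PlaneGraph V D where
  cs : D
  ct : D
  tail_cs : tail cs = s
  tail_ct : tail ct = t
  faces_ne : toPlaneGraph.leftFace cs ≠ toPlaneGraph.leftFace ct

namespace CylinderGraph

variable {V D : Type*} [Fintype V] [Fintype D] {s t : V} (H : CylinderGraph V D s t)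

/-- The two faces whose interiors are removed from the sphere. -/
def IsHole (f : H.Face) : Prop := f = H.leftFace H.cs ∨ f = H.leftFace H.ct

/-- The walks that start at the base vertex `s`, with their ends. -/
def BasedWalk : Type _ := {w : V × List D // H.IsWalk s w.2 w.1}

/-- An elementary homotopy (with fixed ends) on the cylinder: `q` arises from `p` by the insertion
of a dart followed by its reverse, or of a closed walk round a face that is not removed. -/
def HomotopyStep (p q : H.BasedWalk) : Prop :=
  p.1.1 = q.1.1 ∧ ∃ (w₁ w₂ c : List D), p.1.2 = w₁ ++ w₂ ∧ q.1.2 = w₁ ++ c ++ w₂ ∧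
    ∃ d, c = [d, H.rev d] ∨ (¬ H.IsHole (H.leftFace d) ∧ c = H.faceWalk d)

/-- The vertices of the graph drawn on the universal cover of the cylinder: homotopy classes of
walks from `s`. For a graph `G` drawn on the cylinder together with an artificial path, the
covering graph of `G` is the part of this cover that lies over the darts of `G`. -/
def CoverVertex : Type _ := Quot H.HomotopyStep

def coverMk {v : V} (w : List D) (h : H.IsWalk s w v) : H.CoverVertex :=
  Quot.mk _ ⟨(v, w), h⟩

/-- The covering projection on vertices. -/
def proj (x : H.CoverVertex) : V := Quot.lift (fun w => w.1.1) (fun _ _ h => h.1) x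

/-- The darts of the universal cover: a dart over `d` goes from the class of a walk `w` that ends
in the tail of `d` to the class of `w` followed by `d`. -/
structure CoverDart where
  start : H.CoverVertex
  finish : H.CoverVertex
  dart : D
  lifts : ∃ (w : List D) (h : H.IsWalk s w (H.tail dart))
    (h' : H.IsWalk s (w ++ [dart]) (H.head dart)),
    start = H.coverMk w h ∧ finish = H.coverMk (w ++ [dart]) h'

/-- `q` is an isomorphic copy in the cover of the simple path `p`: a path of the cover that
projects to `p`, dart by dart. -/
def IsCopyOfPath (q : List H.CoverDart) (p : List D) : Prop :=
  q.IsChain (fun e e' => e.finish = e'.start) ∧ q.map CoverDart.dart = p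

/-- For a simple path `p` from `s` to `t`: the dart `d` leaves `p` from the left. At an inner vertex
of `p`, these are the darts that follow the reverse of the dart of `p` entering the vertex, in
clockwise order, before the dart of `p` leaving the vertex. At `s` the sweep starts at the
corner `cs`, and at `t` it stops at the corner `ct`. -/
inductive LeavesLeft (p : List D) : D → Prop
  | first : H.cs ∉ p → LeavesLeft p H.cs
  | inner (a : D) : a ∈ p → H.nxt (H.rev a) ∉ p → H.nxt (H.rev a) ≠ H.ct →
      LeavesLeft p (H.nxt (H.rev a))
  | next (d : D) : LeavesLeft p d → H.nxt d ∉ p → H.nxt d ≠ H.ct → LeavesLeft p (H.nxt d)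

open Classical in
/-- The side of `p` from which `d` leaves `p`: `true` for left, `false` for right. -/
noncomputable def side (p : List D) (d : D) : Bool := decide (H.LeavesLeft p d)

/-- Adjacency in the cover cut open along all copies of the path `p`. Each vertex of a copy of `p`
is split in a left vertex `(x, true)` and a right vertex `(x, false)`; the other vertices stay
single, so their two names are identified. Each dart outside the copies is attached to the side from
which it leaves, and each copy of `p` appears twice, once through the left and once through the
right vertices. -/
inductive CutAdj (p : List D) : H.CoverVertex × Bool → H.CoverVertex × Bool → Prop
  | off (x : H.CoverVertex) :
      (∀ d ∈ p, H.proj x ≠ H.tail d ∧ H.proj x ≠ H.head d) → CutAdj p (x, true) (x, false)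
  | edge (e : H.CoverDart) : e.dart ∉ p → H.rev e.dart ∉ p →
      CutAdj p (e.start, H.side p e.dart) (e.finish, H.side p (H.rev e.dart))
  | path (e : H.CoverDart) (b : Bool) : e.dart ∈ p → CutAdj p (e.start, b) (e.finish, b)

/-- The copies of the graph with respect to `p`: the connected components of the cover cut
open along all copies of `p`. -/
def GraphCopy (p : List D) : Type _ := Quot (H.CutAdj p)

/-- The copy of the graph that contains a dart `e` of the cover, if `e` is not on a copy of `p`. -/
noncomputable def graphCopy (p : List D) (e : H.CoverDart) : H.GraphCopy p :=
  Quot.mk _ (e.start, H.side p e.dart)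

end CylinderGraph

/-- A simple curve from `s` to `t` that meets `G` only in vertices and passes through `k` faces,
drawn as a path of `k` artificial edges, one in each of these faces, together with the choice of the
ends of the cylinder. `cyl` is the resulting plane graph; `inl d` is the dart `d` of `G`,
`inr (i, true)` is the `i`-th dart of the curve and `inr (i, false)` is its reverse. -/
structure DrawnCurve {V D : Type*} [Fintype V] [Fintype D] (G : PlaneGraph V D) (s t : V)
    (k : ℕ) where
  cyl : CylinderGraph V (D ⊕ Fin k × Bool) s t
  tail_inl : ∀ d, cyl.tail (Sum.inl d) = G.tail d
  rev_inl : ∀ d, cyl.rev (Sum.inl d) = Sum.inl (G.rev d)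
  /-- If the artificial darts are skipped, the rotation is that of `G`. -/
  nxt_inl : ∀ d, ∃ n : ℕ, (cyl.nxt ^ (n + 1)) (Sum.inl d) = Sum.inl (G.nxt d) ∧
    ∀ m < n, ∃ a, (cyl.nxt ^ (m + 1)) (Sum.inl d) = Sum.inr a
  rev_inr : ∀ i b, cyl.rev (Sum.inr (i, b)) = Sum.inr (i, !b)
  /-- The vertices through which the curve passes. -/
  vertex : Fin (k + 1) → V
  vertex_injective : Function.Injective vertex
  vertex_zero : vertex 0 = s
  vertex_last : vertex (Fin.last k) = t
  tail_inr : ∀ i, cyl.tail (Sum.inr (i, true)) = vertex i.castSucc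
  head_inr : ∀ i, cyl.head (Sum.inr (i, true)) = vertex i.succ

/-- The curve as a path. -/
def DrawnCurve.path {V D : Type*} [Fintype V] [Fintype D] {G : PlaneGraph V D} {s t : V} {k : ℕ}
    (_C : DrawnCurve G s t k) : List (D ⊕ Fin k × Bool) :=
  (List.finRange k).map (fun i => Sum.inr (i, true))

/-- The copies of `G` in the cover, with respect to the curve, that contain a dart of `q`. -/
def DrawnCurve.copiesMeeting {V D : Type*} [Fintype V] [Fintype D] {G : PlaneGraph V D} {s t : V}
    {k : ℕ} (C : DrawnCurve G s t k) (q : List C.cyl.CoverDart) :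
    Set (C.cyl.GraphCopy C.path) :=
  {X | ∃ e ∈ q, C.cyl.graphCopy C.path e = X}

/-!
Walk along the lift of `P` dart by dart. Both ends of a lifted dart of `G` lie in one piece of the
cover, because no dart of `G` is on the curve. At a vertex that is not on the curve nothing is cut,
so two consecutive darts that meet there lie in one copy of `G`
(`CylinderGraph.graphCopy_eq_of_off`). Hence the copy changes only at inner vertices of `P` that lie
on the curve, and the number of copies is at most one more than the number of these vertices
(`CylinderGraph.encard_graphCopy_le`). As `P` is simple, it visits each of the `φ + 1` vertices of
the curve at most once, which gives `φ + 2` copies. If neither `s` nor `t` is an inner vertex of `P`,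
only the `φ - 1` inner vertices of the curve remain, which gives `φ` copies.
-/

namespace PlaneGraph

variable {V D : Type*} [Fintype V] [Fintype D] (G : PlaneGraph V D)

theorem map_tail_sublist_map_head (d : D) (p : List D)
    (h : (d :: p).IsChain (fun d e => G.head d = G.tail e)) :
    (p.map G.tail).Sublist ((d :: p).map G.head) := by
  induction p generalizing d with
  | nil => simp
  | cons a p ih =>
    rw [List.isChain_cons_cons] at h
    rw [List.map_cons, List.map_cons, h.1]
    exact (ih a h.2).cons_cons _

theorem IsSimplePath.nodup_map_tail_tail {G : PlaneGraph V D} {p : List D} (h : G.IsSimplePath p) :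
    (p.tail.map G.tail).Nodup := by
  cases p with
  | nil => simp
  | cons d p =>
    exact (G.map_tail_sublist_map_head d p h.1).nodup (List.nodup_cons.1 h.2).2

end PlaneGraph

namespace CylinderGraph

variable {V D : Type*} [Fintype V] [Fintype D] {s t : V} (H : CylinderGraph V D s t)

theorem proj_start (e : H.CoverDart) : H.proj e.start = H.tail e.dart := by
  obtain ⟨w, h, h', hs, hf⟩ := e.lifts
  rw [hs]
  rfl

theorem graphCopy_eq_of_off {p : List D} {e e' : H.CoverDart} (h : e.finish = e'.start)
    (he : e.dart ∉ p) (he' : H.rev e.dart ∉ p)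
    (hoff : ∀ d ∈ p, H.tail e'.dart ≠ H.tail d ∧ H.tail e'.dart ≠ H.head d) :
    H.graphCopy p e = H.graphCopy p e' := by
  have h₁ : H.graphCopy p e = Quot.mk _ (e.finish, H.side p (H.rev e.dart)) :=
    Quot.sound (.edge e he he')
  have h₂ : (Quot.mk _ (e'.start, true) : H.GraphCopy p) = Quot.mk _ (e'.start, false) :=
    Quot.sound (.off _ (by rwa [proj_start]))
  have h₃ : ∀ b b' : Bool,
      (Quot.mk _ (e'.start, b) : H.GraphCopy p) = Quot.mk _ (e'.start, b') := by
    rintro (_ | _) (_ | _) <;> first | rfl | exact h₂ | exact h₂.symm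
  rw [h₁, h]
  exact h₃ _ _

open Classical in
/-- A path of the cover that avoids the copies of `p` changes the copy of the graph at most once for
each of its inner vertices that lies over a vertex of `p`. -/
theorem encard_graphCopy_le {p : List D} (W : Finset V)
    (hW : ∀ d ∈ p, H.tail d ∈ W ∧ H.head d ∈ W) (e : H.CoverDart) (q : List H.CoverDart)
    (hq : (e :: q).IsChain (fun e e' => e.finish = e'.start))
    (hp : ∀ e' ∈ e :: q, e'.dart ∉ p ∧ H.rev e'.dart ∉ p) :
    {X | ∃ e' ∈ e :: q, H.graphCopy p e' = X}.encard ≤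
      (((q.map fun e' => H.tail e'.dart).filter (· ∈ W)).length : ℕ∞) + 1 := by
  induction q generalizing e with
  | nil => simp [Set.encard_singleton]
  | cons a q ih =>
    rw [List.isChain_cons_cons] at hq
    have hins : {X | ∃ e' ∈ e :: a :: q, H.graphCopy p e' = X} =
        insert (H.graphCopy p e) {X | ∃ e' ∈ a :: q, H.graphCopy p e' = X} := by
      ext X
      rw [Set.mem_insert_iff, Set.mem_ofPred_eq, List.exists_mem_cons_iff, eq_comm (a := X)]
      rfl
    have ih' := ih a hq.2 fun e' he' => hp e' (List.mem_cons_of_mem _ he')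
    rw [hins]
    by_cases ha : H.tail a.dart ∈ W
    · rw [List.map_cons, List.filter_cons_of_pos (by simpa using ha), List.length_cons]
      refine (Set.encard_insert_le _ _).trans ?_
      push_cast
      gcongr
    · have hea : H.graphCopy p e = H.graphCopy p a :=
        H.graphCopy_eq_of_off hq.1 (hp e (by simp)).1 (hp e (by simp)).2 fun d hd =>
          ⟨fun h => ha (h ▸ (hW d hd).1), fun h => ha (h ▸ (hW d hd).2)⟩
      have hmem : H.graphCopy p e ∈ {X | ∃ e' ∈ a :: q, H.graphCopy p e' = X} :=
        ⟨a, by simp, hea.symm⟩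
      rw [Set.insert_eq_of_mem hmem, List.map_cons,
        List.filter_cons_of_neg (by simpa using ha)]
      exact ih'

end CylinderGraph

open Classical in
/-- If all inner vertices of `P` on the curve belong to `U`, then a lift of the simple path `P` meets
at most `|U| + 1` copies of `G`. -/
theorem DrawnCurve.encard_copiesMeeting_le {V D : Type*} [Fintype V] [Fintype D]
    {G : PlaneGraph V D} {s t : V} {k : ℕ} (C : DrawnCurve G s t k) {P : List D}
    (hP : G.IsSimplePath P) {q : List C.cyl.CoverDart}
    (hq : C.cyl.IsCopyOfPath q (P.map Sum.inl)) (U : Finset V)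
    (hU : ∀ d ∈ P.tail, ∀ i, C.vertex i = G.tail d → G.tail d ∈ U) :
    (C.copiesMeeting q).encard ≤ (U.card : ℕ∞) + 1 := by
  obtain ⟨hchain, hmap⟩ := hq
  cases q with
  | nil => simp [copiesMeeting]
  | cons e q =>
    cases P with
    | nil => simp at hmap
    | cons d P =>
      rw [List.map_cons, List.map_cons, List.cons.injEq] at hmap
      have hinl : ∀ e' ∈ e :: q, ∃ a, e'.dart = Sum.inl a := by
        intro e' he'
        rcases List.mem_cons.1 he' with rfl | he'
        · exact ⟨d, hmap.1⟩
        · have : e'.dart ∈ P.map Sum.inl := hmap.2 ▸ List.mem_map_of_mem he'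
          obtain ⟨a, -, ha⟩ := List.mem_map.1 this
          exact ⟨a, ha.symm⟩
      have htail : (q.map fun e' => C.cyl.tail e'.dart) = P.map G.tail := by
        rw [← Function.comp_def C.cyl.tail, ← List.map_map, hmap.2, List.map_map]
        exact List.map_congr_left fun a _ => C.tail_inl a
      have hbound := C.cyl.encard_graphCopy_le (p := C.path) (Finset.univ.image C.vertex)
        (by
          intro a ha
          obtain ⟨i, -, rfl⟩ := List.mem_map.1 ha
          rw [C.tail_inr, C.head_inr]
          simp)
        e q hchain
        (by
          intro e' he'
          obtain ⟨a, ha⟩ := hinl e' he'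
          rw [ha, C.rev_inl]
          simp [path])
      refine hbound.trans ?_
      rw [htail]
      gcongr
      have hnodup : (P.map G.tail).Nodup := hP.nodup_map_tail_tail
      rw [← List.toFinset_card_of_nodup (hnodup.filter _)]
      refine Finset.card_le_card fun v hv => ?_
      simp only [List.mem_toFinset, List.mem_filter, List.mem_map,
        decide_eq_true_eq, Finset.mem_image, Finset.mem_univ, true_and] at hv
      obtain ⟨⟨a, ha, rfl⟩, i, hi⟩ := hv
      exact hU a ha i hi

theorem mainTheorem8 {V D : Type*} [Fintype V] [Fintype D] (G : PlaneGraph V D)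
    (s t : V) (hst : s ≠ t)
    (C : DrawnCurve G s t (G.phi s t))
    (P : List D) (hP : G.IsSimplePath P)
    (Pbar : List C.cyl.CoverDart) (hPbar : C.cyl.IsCopyOfPath Pbar (P.map Sum.inl)) :
    (C.copiesMeeting Pbar).encard ≤ (G.phi s t : ℕ∞) + 2 ∧
      ((∀ d ∈ P.tail, G.tail d ≠ s ∧ G.tail d ≠ t) →
        (C.copiesMeeting Pbar).encard ≤ (G.phi s t : ℕ∞)) := by
  classical
  have hcard : (Finset.univ.image C.vertex).card = G.phi s t + 1 := by
    rw [Finset.card_image_of_injective _ C.vertex_injective, Finset.card_fin]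
  constructor
  · refine (C.encard_copiesMeeting_le hP hPbar (Finset.univ.image C.vertex)
      fun d _ i hi => hi ▸ Finset.mem_image_of_mem _ (Finset.mem_univ i)).trans ?_
    rw [hcard]
    norm_cast
  · intro hinner
    refine (C.encard_copiesMeeting_le hP hPbar (((Finset.univ.image C.vertex).erase s).erase t)
      fun d hd i hi => Finset.mem_erase.2 ⟨(hinner d hd).2, Finset.mem_erase.2
        ⟨(hinner d hd).1, hi ▸ Finset.mem_image_of_mem _ (Finset.mem_univ i)⟩⟩).trans ?_
    have hs : s ∈ Finset.univ.image C.vertex :=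
      Finset.mem_image.2 ⟨0, Finset.mem_univ _, C.vertex_zero⟩
    have ht : t ∈ (Finset.univ.image C.vertex).erase s :=
      Finset.mem_erase.2
        ⟨hst.symm, Finset.mem_image.2 ⟨Fin.last _, Finset.mem_univ _, C.vertex_last⟩⟩
    have h₁ := Finset.card_erase_add_one hs
    have h₂ := Finset.card_erase_add_one ht
    norm_cast
    omega
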